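/- Consider $m$ users, the vertices of an undirected simple graph $G=(V,E)$, who all face the same stochastic bandit problem with arms $1,\dots,K$ ($K\ge 1$). Let $P_1,\dots,P_K$ be probability distributions supported on $[0,1]$, with means $\mu_1,\dots,\mu_K$; put $\mu^*=\max_i\mu_i$ and $\Delta_i=\mu^*-\mu_i$. The rewards $X^v_i(t)$ ($v\in V$, $1\le i\le K$, $t\ge 1$) are independent random variables, and $X^v_i(t)$ has distribution $P_i$. In round $t$ each user $v$ chooses an arm $a^v(t)$ and receives $X^v_{a^v(t)}(t)$. Before choosing $a^v(t+1)$ it knows the choices and rewards, in rounds $1,\dots,t$, of all users in $\mathcal N(v)=\{v\}\cup\{u: \{u,v\}\in E\}$. Let $m^v_i(t)$ be the number of times that arm $i$ was chosen by users of $\mathcal N(v)$ in rounds $1,\dots,t$, and let $\hat\mu^v_i(t)$ be the average of the corresponding rewards. All users follow the UCB-Network policy: $a^v(t)=t$ for $1\le t\le K$, and for $t\ge K$ $$a^v(t+1)\in\operatorname*{argmax}_{j}\Big(\hat\mu^v_j(t)+\sqrt{\tfrac{2\ln t}{m^v_j(t)}}\Big),$$ where ties are broken by an arbitrary fixed measurable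 function of the information available to $v$. Let $R^G(n)=\sum_{v\in V}\sum_{t=1}^n(\mu^*-\mu_{a^v(t)})$ be the regret of the network up to the horizon $n\ge 1$. For $\beta\in(1/4,1)$ put $$b=m\left(\frac{2}{4\beta-1}+\frac{2}{(4\beta-1)^2\ln(1/\beta)}\right)\sum_{j=1}^K\Delta_j,\qquad S=\sum_{i:\mu_i<\mu^*}\left(\frac{8\ln n}{\Delta_i}+\Delta_i\right).$$ Then $R^G(n)$ is integrable and, for every $\beta\in(1/4,1)$: 1. if $G$ is fully connected (the complete graph), then $\mathbb E[R^G(n)]\le S+b$; 2. if $G$ is circular (the cycle on $m\ge 2$ vertices, a single edge when $m=2$), then $\mathbb E[R^G(n)]\le\lfloor m/2\rfloor\, S+b$; 3. if $G$ is a star on $m\ge 2$ vertices (one center adjacent to all the other vertices, and no other edges), then $\mathbb E[R^G(n)]\le(m-1)\,S+b$; 4. if $G$ is fully disconnected (no edges), then $\mathbb E[R^G(n)]\le m\,S+b$. -/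

import Mathlib

open MeasureTheory ProbabilityTheory

namespace NetworkBandit

section Information

variable {V : Type*} [Fintype V] {K : ℕ}

open Classical in
/-- The closed neighbourhood of `v`: the user `v` and its one-hop neighbours. -/
noncomputable def closedNbhd (G : SimpleGraph V) (v : V) : Finset V :=
  Finset.univ.filter fun u => u = v ∨ G.Adj v u

/-- The information available to user `v` after `t` rounds: for every user `u` in the closed
neighbourhood of `v` and every one of the `t` rounds played so far, the arm chosen by `u` in that
round and the reward that `u` received. Rounds and arms are numbered from `0`. -/
abbrev History (K : ℕ) (G : SimpleGraph V) (v : V) (t : ℕ) : Type _ :=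
  {u : V // u ∈ closedNbhd G v} → Fin t → Fin K × ℝ

/-- A (deterministic) network policy: `Φ v t h` is the arm which user `v` plays right after the
first `t` rounds, on the basis of its information `h` about these rounds. -/
abbrev Policy (K : ℕ) (G : SimpleGraph V) : Type _ :=
  (v : V) → (t : ℕ) → History K G v t → Fin K

variable {G : SimpleGraph V} {v : V} {t : ℕ}

/-- The number of times that arm `i` was chosen in the closed neighbourhood of `v`. -/
noncomputable def History.count (h : History K G v t) (i : Fin K) : ℕ :=
  ∑ u, ∑ s, if (h u s).1 = i then 1 else 0

/-- The average of the rewards of arm `i` that were collected in the closed neighbourhood of `v`. -/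
noncomputable def History.avgReward (h : History K G v t) (i : Fin K) : ℝ :=
  (∑ u, ∑ s, if (h u s).1 = i then (h u s).2 else 0) / (h.count i : ℝ)

/-- The upper confidence bound of arm `i` computed by `v` after `t` rounds. -/
noncomputable def History.ucbIndex (h : History K G v t) (i : Fin K) : ℝ :=
  h.avgReward i + √(2 * Real.log t / (h.count i : ℝ))

/-- `Φ` is a UCB-Network policy: every user plays each arm once, in order, in the first `K` rounds,
and afterwards an arm of largest upper confidence bound. Ties may be broken by any measurable
function of the information of the user. (After the first `K` rounds every arm has been sampled, so
histories in which some arm was not sampled never occur, and nothing is required on these.) -/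
structure IsUCBNetwork (Φ : Policy K G) : Prop where
  measurable : ∀ v t, Measurable (Φ v t)
  init : ∀ v t (h : History K G v t), t < K → (Φ v t h : ℕ) = t
  loop : ∀ v t (h : History K G v t), K ≤ t → (∀ j, 0 < h.count j) →
    ∀ j, h.ucbIndex j ≤ h.ucbIndex (Φ v t h)

end Information

section Dynamics

variable {V : Type*} [Fintype V] {K : ℕ} {G : SimpleGraph V}

/-- The arm chosen by user `v` in round `t` (rounds are numbered from `0`) when the network follows
`Φ` and `x u i s` is the reward which user `u` gets in round `s` if it plays arm `i` then. -/
noncomputable def action (Φ : Policy K G) (x : V → Fin K → ℕ → ℝ) (t : ℕ) (v : V) : Fin K :=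
  Φ v t fun u s => (action Φ x s u, x u (action Φ x s u) s)
termination_by t
decreasing_by all_goals exact s.isLt

/-- The mean reward `μ_i` of arm `i`, whose reward distribution is `P i`. -/
noncomputable def armMean (P : Fin K → Measure ℝ) (i : Fin K) : ℝ := ∫ y, y ∂(P i)

/-- The largest mean reward `μ^*`. -/
noncomputable def bestMean (P : Fin K → Measure ℝ) : ℝ := ⨆ i, armMean P i

/-- The gap `Δ_i = μ^* - μ_i`. -/
noncomputable def gap (P : Fin K → Measure ℝ) (i : Fin K) : ℝ := bestMean P - armMean P i

/-- The regret of the whole network in the first `n` rounds, `∑_v ∑_t (μ^* - μ_{a^v(t)})`. -/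
noncomputable def networkRegret (P : Fin K → Measure ℝ) (Φ : Policy K G)
    (x : V → Fin K → ℕ → ℝ) (n : ℕ) : ℝ :=
  ∑ v, ∑ t ∈ Finset.range n, (bestMean P - armMean P (action Φ x t v))

open Classical in
/-- `∑_{i : μ_i < μ^*} (8 ln n / Δ_i + Δ_i)`. -/
noncomputable def mainTerm (P : Fin K → Measure ℝ) (n : ℕ) : ℝ :=
  ∑ i ∈ Finset.univ.filter (fun i => armMean P i < bestMean P),
    (8 * Real.log n / gap P i + gap P i)

/-- The constant
`b = m (2 / (4β - 1) + 2 / ((4β - 1)^2 ln (1/β))) ∑_j Δ_j`. -/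
noncomputable def addTerm (P : Fin K → Measure ℝ) (m : ℕ) (β : ℝ) : ℝ :=
  m * (2 / (4 * β - 1) + 2 / ((4 * β - 1) ^ 2 * Real.log (1 / β))) * ∑ j, gap P j

end Dynamics

/-- The reward model: `X v i t` is the reward which user `v` gets from arm `i` in round `t`. All
these rewards are independent, those of arm `i` have distribution `P i`, and rewards lie
in `[0, 1]`. -/
structure IsRewardModel {V Ω : Type*} {K : ℕ} [MeasurableSpace Ω] (P : Fin K → Measure ℝ)
    (X : V → Fin K → ℕ → Ω → ℝ) (Pr : Measure Ω) : Prop where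
  measurable : ∀ v i t, Measurable (X v i t)
  law : ∀ v i t, Measure.map (X v i t) Pr = P i
  indep : iIndepFun (fun p : V × Fin K × ℕ => X p.1 p.2.1 p.2.2) Pr
  bounded : ∀ i, ∀ᵐ y ∂(P i), y ∈ Set.Icc (0 : ℝ) 1

end NetworkBandit

open NetworkBandit

namespace NetworkBandit

/-! ### Early plays and independent sets -/

section Graph

variable {V : Type*} [Fintype V] {G : SimpleGraph V}

/-! The regret is the sum over suboptimal arms `i` of `Δ_i` times the number of plays of `i` by all
users. Fix such an arm and `l ≈ 8 ln n / Δ_i²`. A play of `i` by `v` is early if fewer than `l`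
plays of `i` took place before it in the closed neighbourhood of `v`, and late otherwise.

Early plays are a matter of combinatorics: there are at most `l` times the independence number of
`G`, plus one per user (`exists_isIndepSet_sum_card_early_le`). The shape of the graph matters only
here; the independence number is at most `1`, `⌊m/2⌋`, `m - 1`, `m` in the four cases.

A late play forces the failure of a confidence bound (`IsUCBNetwork.deviation_large`). The sample
sizes are random and depend on past rewards, so Hoeffding's inequality for a fixed sample does not
apply. Instead the pooled centred rewards carry an exponential supermartingale
(`IsRewardModel.lintegral_exp_deviation_le_one`), and peeling over the sample size
(`measure_sqrt_le_le`) bounds the probability of each failure by `t⁻³`. Hence each user makes at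
most `1/2` late plays of `i` in expectation.

Beyond the main term this costs `3/2 * Δ_i` per user and arm, which fits into `b`, whose coefficient
is at least `2` for every `β` (`two_le_addTerm_coeff`). -/

theorem mem_closedNbhd {u v : V} : u ∈ closedNbhd G v ↔ u = v ∨ G.Adj v u := by
  simp [closedNbhd]

theorem self_mem_closedNbhd (v : V) : v ∈ closedNbhd G v := mem_closedNbhd.2 (Or.inl rfl)

/-- Suppose that `A s v` says that `v` plays in round `s`, and call a play of `v` early if at most
`l` plays took place before it in the closed neighbourhood of `v`. The number of early plays in `S`
is at most `l` times the size of an independent subset of `S`, up to one play per vertex. -/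
theorem exists_isIndepSet_sum_card_early_le (A : ℕ → V → Prop) [∀ s, DecidablePred (A s)]
    (l n : ℕ) (S : Finset V) :
    ∃ I ⊆ S, G.IsIndepSet (I : Set V) ∧
      ∑ v ∈ S, ((Finset.range n).filter fun t => A t v ∧
        ∑ u ∈ closedNbhd G v, ((Finset.range t).filter fun s => A s u).card < l).card
        ≤ I.card * l + S.card := by
  classical
  induction S using Finset.strongInduction with
  | H S ih =>
  set B : V → Finset ℕ := fun v => (Finset.range n).filter fun t => A t v ∧
    ∑ u ∈ closedNbhd G v, ((Finset.range t).filter fun s => A s u).card < l with hB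
  by_cases hne : (S.biUnion B).Nonempty
  -- Greedy choice: take a latest early play, by `v` in round `T`, and delete the closed
  -- neighbourhood of `v`. Earliness on the remaining vertices is still measured in all of `G`.
  · obtain ⟨v, hvS, hvT⟩ := Finset.mem_biUnion.1 (Finset.max'_mem _ hne)
    set T := (S.biUnion B).max' hne with hT
    have hmax : ∀ u ∈ S, ∀ t ∈ B u, t ≤ T := fun u hu t ht =>
      Finset.le_max' _ _ (Finset.mem_biUnion.2 ⟨u, hu, ht⟩)
    obtain ⟨I, hIS, hI, hsum⟩ := ih (S \ closedNbhd G v)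
      (Finset.ssubset_iff_of_subset Finset.sdiff_subset |>.2
        ⟨v, hvS, by simp [self_mem_closedNbhd]⟩)
    have hvI : v ∉ I := fun h => (Finset.mem_sdiff.1 (hIS h)).2 (self_mem_closedNbhd v)
    refine ⟨insert v I, ?_, ?_, ?_⟩
    · exact Finset.insert_subset hvS (hIS.trans Finset.sdiff_subset)
    · rw [Finset.coe_insert, SimpleGraph.isIndepSet_iff, Set.pairwise_insert]
      refine ⟨hI, fun u hu _ => ?_⟩
      have h : ¬ G.Adj v u := fun h =>
        (Finset.mem_sdiff.1 (hIS hu)).2 (mem_closedNbhd.2 (Or.inr h))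
      exact ⟨h, fun h' => h h'.symm⟩
    -- As `T` is the latest round, the early plays of the deleted vertices lie before `T`, up to one
    -- per vertex in round `T` itself. Those before `T` number less than `l`, because the play of
    -- `v` in round `T` is early.
    · have h1 : ∀ u ∈ S ∩ closedNbhd G v,
          (B u).card ≤ ((Finset.range T).filter fun s => A s u).card + 1 := by
        intro u hu
        have hsub : B u ⊆ insert T ((Finset.range T).filter fun s => A s u) := by
          intro t ht
          have h2 := hmax u (Finset.mem_inter.1 hu).1 t ht
          simp only [hB, Finset.mem_filter] at ht
          rcases h2.eq_or_lt with h | h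
          · simp [h]
          · simp [h, ht.2.1]
        exact (Finset.card_le_card hsub).trans (Finset.card_insert_le _ _)
      have h2 : ∑ u ∈ S ∩ closedNbhd G v, (B u).card ≤ l + (S ∩ closedNbhd G v).card := by
        refine (Finset.sum_le_sum h1).trans ?_
        rw [Finset.sum_add_distrib, Finset.sum_const, smul_eq_mul, mul_one]
        gcongr
        refine (Finset.sum_le_sum_of_subset Finset.inter_subset_right).trans ?_
        simp only [hB, Finset.mem_filter] at hvT
        exact hvT.2.2.le
      have h3 := Finset.sum_inter_add_sum_sdiff S (closedNbhd G v) fun u => (B u).card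
      have h4 := Finset.card_inter_add_card_sdiff S (closedNbhd G v)
      rw [Finset.card_insert_of_notMem hvI, add_mul, one_mul]
      change ∑ u ∈ S, (B u).card ≤ _
      change ∑ u ∈ S \ closedNbhd G v, (B u).card ≤ _ at hsum
      omega
  · refine ⟨∅, by simp, by simp [SimpleGraph.isIndepSet_iff], ?_⟩
    rw [Finset.sum_eq_zero]
    · simp
    · intro v hv
      rw [Finset.card_eq_zero, ← Finset.not_nonempty_iff_eq_empty]
      exact fun ⟨t, ht⟩ => hne ⟨t, Finset.mem_biUnion.2 ⟨v, hv, ht⟩⟩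

omit [Fintype V] in
theorem isIndepSet_top_card_le {I : Finset V} (hI : (⊤ : SimpleGraph V).IsIndepSet (I : Set V)) :
    I.card ≤ 1 :=
  Finset.card_le_one.2 fun a ha b hb => by
    by_contra hab
    exact hI ha hb hab hab

theorem isIndepSet_starGraph_card_lt (hV : 2 ≤ Fintype.card V) {c : V} {I : Finset V}
    (hI : (SimpleGraph.starGraph c).IsIndepSet (I : Set V)) : I.card < Fintype.card V := by
  obtain ⟨u, hu⟩ := Fintype.exists_ne_of_one_lt_card hV c
  by_cases hc : c ∈ I
  · exact Finset.card_lt_univ_of_notMem (x := u) fun h =>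
      hI hc h hu.symm (SimpleGraph.starGraph_center_adj hu.symm)
  · exact Finset.card_lt_univ_of_notMem hc

omit [Fintype V] in
theorem isIndepSet_cycleGraph_card_le {m : ℕ} (hm : 2 ≤ m) (e : G ≃g SimpleGraph.cycleGraph m)
    {I : Finset V} (hI : G.IsIndepSet (I : Set V)) : I.card ≤ m / 2 := by
  classical
  obtain ⟨k, rfl⟩ : ∃ k, m = k + 2 := ⟨m - 2, by omega⟩
  set J := I.map e.toEquiv.toEmbedding with hJ
  have hJc : J.card = I.card := Finset.card_map _
  -- An independent set of the cycle is disjoint from its rotation by one, so twice its size is at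
  -- most `m`.
  have hdisj : Disjoint J (J.map (Equiv.addRight (1 : Fin (k + 2))).toEmbedding) := by
    rw [Finset.disjoint_left]
    intro a ha hb
    obtain ⟨b, hbJ, rfl⟩ := Finset.mem_map.1 hb
    obtain ⟨u, hu, rfl⟩ := Finset.mem_map.1 hbJ
    obtain ⟨w, hw, hwu⟩ := Finset.mem_map.1 ha
    have hadj : G.Adj w u := by
      rw [← e.map_adj_iff, SimpleGraph.cycleGraph_adj]
      left
      have : e w = e u + 1 := hwu
      rw [this]; simp
    exact hI hw hu hadj.ne hadj
  have h := Finset.card_le_univ (J.disjUnion _ hdisj)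
  rw [Finset.card_disjUnion, Finset.card_map _ (s := J), hJc, Fintype.card_fin] at h
  omega

end Graph
-- Pooled counts, centred sums and the confidence bounds
section Counts

variable {V : Type*} [Fintype V] {K : ℕ} {G : SimpleGraph V}

/-- The number of plays of arm `i` in the closed neighbourhood of `v` during the first `t`
rounds. -/
noncomputable def pulls (Φ : Policy K G) (x : V → Fin K → ℕ → ℝ) (v : V) (i : Fin K) (t : ℕ) : ℕ :=
  ∑ u ∈ closedNbhd G v, ((Finset.range t).filter fun s => action Φ x s u = i).card

/-- The sum of the rewards of arm `i`, each reduced by `c`, which were collected in the closed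
neighbourhood of `v` during the first `t` rounds. -/
noncomputable def deviation (Φ : Policy K G) (x : V → Fin K → ℕ → ℝ) (c : ℝ) (v : V) (i : Fin K)
    (t : ℕ) : ℝ :=
  ∑ u ∈ closedNbhd G v, ∑ s ∈ Finset.range t, if action Φ x s u = i then x u i s - c else 0

theorem pulls_succ (Φ : Policy K G) (x : V → Fin K → ℕ → ℝ) (v : V) (i : Fin K) (t : ℕ) :
    pulls Φ x v i (t + 1) =
      pulls Φ x v i t + ((closedNbhd G v).filter fun u => action Φ x t u = i).card := by
  simp only [pulls, Finset.card_filter, Finset.sum_range_succ, Finset.sum_add_distrib]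

theorem deviation_succ (Φ : Policy K G) (x : V → Fin K → ℕ → ℝ) (c : ℝ) (v : V) (i : Fin K)
    (t : ℕ) :
    deviation Φ x c v i (t + 1) = deviation Φ x c v i t +
      ∑ u ∈ (closedNbhd G v).filter fun u => action Φ x t u = i, (x u i t - c) := by
  simp only [deviation, Finset.sum_filter, Finset.sum_range_succ, Finset.sum_add_distrib]

variable {Φ : Policy K G} {x : V → Fin K → ℕ → ℝ} {v : V} {i : Fin K} {t : ℕ}

theorem action_eq (Φ : Policy K G) (x : V → Fin K → ℕ → ℝ) (t : ℕ) (v : V) :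
    action Φ x t v = Φ v t fun u s => (action Φ x s u, x u (action Φ x s u) s) := by
  rw [action]

theorem count_eq_pulls : History.count (G := G) (v := v) (t := t)
    (fun u s => (action Φ x s u, x u (action Φ x s u) s)) i = pulls Φ x v i t := by
  simp only [History.count, pulls, Finset.card_filter]
  rw [← Finset.sum_coe_sort (closedNbhd G v)]
  refine Finset.sum_congr rfl fun u _ => ?_
  exact Fin.sum_univ_eq_sum_range (fun s => if action Φ x s u = i then 1 else 0) t

/-- Passes from the averages used by the policy to undivided centred sums, the quantities controlled
by the supermartingale. -/
theorem avgReward_mul_pulls (c : ℝ) (h : pulls Φ x v i t ≠ 0) :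
    (History.avgReward (G := G) (v := v) (t := t)
      (fun u s => (action Φ x s u, x u (action Φ x s u) s)) i - c) * pulls Φ x v i t =
        deviation Φ x c v i t := by
  have h' : (pulls Φ x v i t : ℝ) ≠ 0 := by exact_mod_cast h
  rw [History.avgReward, count_eq_pulls, sub_mul, div_mul_cancel₀ _ h']
  simp only [deviation, pulls, Finset.card_filter]
  push_cast
  rw [Finset.mul_sum, ← Finset.sum_coe_sort (closedNbhd G v),
    ← Finset.sum_coe_sort (closedNbhd G v), ← Finset.sum_sub_distrib]
  refine Finset.sum_congr rfl fun u _ => ?_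
  rw [Fin.sum_univ_eq_sum_range
    (fun s => if action Φ x s u = i then x u (action Φ x s u) s else 0) t, Finset.mul_sum,
    ← Finset.sum_sub_distrib]
  refine Finset.sum_congr rfl fun s _ => ?_
  split_ifs with hs
  · simp [hs]
  · simp

theorem pulls_le : pulls Φ x v i t ≤ (closedNbhd G v).card * t := by
  rw [pulls, ← smul_eq_mul, ← Finset.sum_const]
  refine Finset.sum_le_sum fun u _ => (Finset.card_filter_le _ _).trans (by simp)

theorem card_closedNbhd_pos : 0 < (closedNbhd G v).card :=
  Finset.card_pos.2 ⟨v, self_mem_closedNbhd v⟩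

theorem IsUCBNetwork.action_of_lt (hΦ : IsUCBNetwork Φ) (ht : t < K) :
    (action Φ x t v : ℕ) = t := by
  rw [action_eq]; exact hΦ.init v t _ ht

/-- The initial rounds give each neighbour one play of every arm. With `pulls_le`, the count lies
between `q` and `q * t` for `q` the neighbourhood size, so the number of shells in the peeling does
not depend on `q`. -/
theorem IsUCBNetwork.le_pulls (hΦ : IsUCBNetwork Φ) (ht : K ≤ t) :
    (closedNbhd G v).card ≤ pulls Φ x v i t := by
  rw [pulls, Finset.card_eq_sum_ones]
  refine Finset.sum_le_sum fun u _ => Finset.card_pos.2 ⟨i, ?_⟩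
  rw [Finset.mem_filter, Finset.mem_range]
  exact ⟨i.2.trans_le ht, Fin.ext (hΦ.action_of_lt i.2)⟩

/-- All users run through the arms in the same order, so plays of the initial phase find no earlier
sample and are always early. -/
theorem IsUCBNetwork.pulls_eq_zero (hΦ : IsUCBNetwork Φ) (ht : t < K)
    (h : action Φ x t v = i) : pulls Φ x v i t = 0 := by
  refine Finset.sum_eq_zero fun u _ => ?_
  rw [Finset.card_eq_zero, Finset.filter_eq_empty_iff]
  intro s hs hsi
  rw [Finset.mem_range] at hs
  have h1 := hΦ.action_of_lt (x := x) (v := v) ht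
  have h2 := hΦ.action_of_lt (x := x) (v := u) (hs.trans ht)
  rw [h] at h1; rw [hsi] at h2
  omega

/-- If an arm with gap `d` is played after at least `8 ln t / d ^ 2` plays in the neighbourhood,
then one of the two confidence bounds involved is violated. -/
theorem IsUCBNetwork.deviation_large (hΦ : IsUCBNetwork Φ) (ht : K ≤ t) {j : Fin K} {c d : ℝ}
    (hd : 0 < d) (h : action Φ x t v = i) (hp : 8 * Real.log t / d ^ 2 ≤ pulls Φ x v i t) :
    √(2 * Real.log t * pulls Φ x v i t) ≤ deviation Φ x (c - d) v i t ∨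
      √(2 * Real.log t * pulls Φ x v j t) ≤ -deviation Φ x c v j t := by
  have hpos : ∀ k, 0 < pulls Φ x v k t := fun k => card_closedNbhd_pos.trans_le (hΦ.le_pulls ht)
  have hlog : 0 ≤ 2 * Real.log t := mul_nonneg zero_le_two (Real.log_natCast_nonneg t)
  have hsq : ∀ k, √(2 * Real.log t * pulls Φ x v k t) =
      √(2 * Real.log t / pulls Φ x v k t) * pulls Φ x v k t := by
    intro k
    have hk : (0 : ℝ) < pulls Φ x v k t := by exact_mod_cast hpos k
    rw [Real.sqrt_eq_iff_mul_self_eq (mul_nonneg hlog hk.le) (by positivity), mul_mul_mul_comm,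
      Real.mul_self_sqrt (div_nonneg hlog hk.le)]
    field_simp
  have hucb := hΦ.loop v t (fun u s => (action Φ x s u, x u (action Φ x s u) s)) ht
    (fun k => by rw [count_eq_pulls]; exact hpos k) j
  rw [← action_eq Φ x t v, h] at hucb
  simp only [History.ucbIndex, count_eq_pulls] at hucb
  rw [hsq i, hsq j, ← avgReward_mul_pulls _ (hpos i).ne', ← avgReward_mul_pulls _ (hpos j).ne',
    ← neg_mul, mul_le_mul_iff_left₀ (by exact_mod_cast hpos i),
    mul_le_mul_iff_left₀ (by exact_mod_cast hpos j)]
  -- If both bounds hold, then `c < index j ≤ index i < (c - d) + 2 * bonus i`. So `d` is less than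
  -- twice the bonus of `i`, which contradicts the number of samples.
  by_contra! hcon
  have hi : (0 : ℝ) < pulls Φ x v i t := by exact_mod_cast hpos i
  have h2 : d < 2 * √(2 * Real.log t / pulls Φ x v i t) := by linarith [hcon.1, hcon.2]
  have h3 : d ^ 2 < 4 * (2 * Real.log t / pulls Φ x v i t) := by
    rw [← Real.sq_sqrt (div_nonneg hlog hi.le)]
    nlinarith
  rw [div_le_iff₀ (by positivity)] at hp
  rw [← mul_div_assoc, lt_div_iff₀ hi] at h3
  linarith

end Counts

/-! ### Measurability and predictability of the play -/

section Measurability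

variable {V Ω : Type*} [Fintype V] {K : ℕ} {G : SimpleGraph V} {Φ : Policy K G}
  {X : V → Fin K → ℕ → Ω → ℝ} {t : ℕ}

/-- Only rewards of rounds before `t` are assumed measurable and the σ-algebra is free. The lemma
thus yields both ordinary measurability and predictability, with `rewardsBefore X t` as σ-algebra.
-/
theorem IsUCBNetwork.measurable_action (hΦ : IsUCBNetwork Φ) {mΩ : MeasurableSpace Ω}
    (hX : ∀ v i s, s < t → Measurable (X v i s)) (v : V) :
    Measurable fun ω => action Φ (fun v i s => X v i s ω) t v := by
  induction t using Nat.strong_induction_on generalizing v with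
  | _ t ih =>
  simp only [action_eq Φ _ t v]
  refine (hΦ.measurable v t).comp (measurable_pi_lambda _ fun u => measurable_pi_lambda _ fun s => ?_)
  have h := ih s s.2 (fun v i r hr => hX v i r (hr.trans s.2)) u
  refine h.prodMk ?_
  have h2 : Measurable fun p : Fin K × Ω => X u p.1 s p.2 :=
    measurable_from_prod_countable_right fun i => hX u i s s.2
  exact h2.comp (h.prodMk measurable_id)

theorem IsUCBNetwork.measurableSet_action_eq (hΦ : IsUCBNetwork Φ) {mΩ : MeasurableSpace Ω}
    (hX : ∀ v i s, s < t → Measurable (X v i s)) (v : V) (i : Fin K) :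
    MeasurableSet {ω | action Φ (fun v i s => X v i s ω) t v = i} :=
  hΦ.measurable_action hX v (measurableSet_singleton i)

theorem IsUCBNetwork.measurable_pulls (hΦ : IsUCBNetwork Φ) {mΩ : MeasurableSpace Ω}
    (hX : ∀ v i s, s < t → Measurable (X v i s)) (v : V) (i : Fin K) :
    Measurable fun ω => pulls Φ (fun v i s => X v i s ω) v i t := by
  simp only [pulls, Finset.card_filter]
  refine Finset.measurable_fun_sum _ fun u _ => Finset.measurable_fun_sum _ fun s hs => ?_
  rw [Finset.mem_range] at hs
  exact Measurable.ite (hΦ.measurableSet_action_eq (fun v i r hr => hX v i r (hr.trans hs)) u i)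
    measurable_const measurable_const

theorem IsUCBNetwork.measurable_deviation (hΦ : IsUCBNetwork Φ) {mΩ : MeasurableSpace Ω}
    (hX : ∀ v i s, s < t → Measurable (X v i s)) (c : ℝ) (v : V) (i : Fin K) :
    Measurable fun ω => deviation Φ (fun v i s => X v i s ω) c v i t := by
  simp only [deviation]
  refine Finset.measurable_fun_sum _ fun u _ => Finset.measurable_fun_sum _ fun s hs => ?_
  rw [Finset.mem_range] at hs
  exact Measurable.ite (hΦ.measurableSet_action_eq (fun v i r hr => hX v i r (hr.trans hs)) u i)
    ((hX u i s hs).sub_const _) measurable_const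

end Measurability

/-! ### The exponential supermartingale -/

section Supermartingale

variable {V Ω : Type*} {K : ℕ} {X : V → Fin K → ℕ → Ω → ℝ}

/-- The σ-algebra generated by the rewards of the first `t` rounds. -/
abbrev rewardsBefore (X : V → Fin K → ℕ → Ω → ℝ) (t : ℕ) : MeasurableSpace Ω :=
  ⨆ p ∈ {p : V × Fin K × ℕ | p.2.2 < t},
    MeasurableSpace.comap (X p.1 p.2.1 p.2.2) inferInstance

/-- The σ-algebra generated by the rewards of round `t`. -/
abbrev rewardsAt (X : V → Fin K → ℕ → Ω → ℝ) (t : ℕ) : MeasurableSpace Ω :=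
  ⨆ p ∈ {p : V × Fin K × ℕ | p.2.2 = t},
    MeasurableSpace.comap (X p.1 p.2.1 p.2.2) inferInstance

theorem measurable_rewardsBefore {v : V} {i : Fin K} {s t : ℕ} (h : s < t) :
    Measurable[rewardsBefore X t] (X v i s) := by
  rw [measurable_iff_comap_le]
  exact le_iSup₂_of_le (f := fun p (_ : p ∈ {p : V × Fin K × ℕ | p.2.2 < t}) =>
    MeasurableSpace.comap (X p.1 p.2.1 p.2.2) inferInstance) (v, i, s) h le_rfl

theorem measurable_rewardsAt (v : V) (i : Fin K) (t : ℕ) :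
    Measurable[rewardsAt X t] (X v i t) := by
  rw [measurable_iff_comap_le]
  exact le_iSup₂_of_le (f := fun p (_ : p ∈ {p : V × Fin K × ℕ | p.2.2 = t}) =>
    MeasurableSpace.comap (X p.1 p.2.1 p.2.2) inferInstance) (v, i, t) rfl le_rfl

variable [mΩ : MeasurableSpace Ω] {P : Fin K → Measure ℝ} {Pr : Measure Ω}

theorem IsRewardModel.rewardsBefore_le (hX : IsRewardModel P X Pr) (t : ℕ) :
    rewardsBefore X t ≤ mΩ :=
  iSup₂_le fun p _ => (hX.measurable p.1 p.2.1 p.2.2).comap_le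

theorem IsRewardModel.rewardsAt_le (hX : IsRewardModel P X Pr) (t : ℕ) :
    rewardsAt X t ≤ mΩ :=
  iSup₂_le fun p _ => (hX.measurable p.1 p.2.1 p.2.2).comap_le

theorem IsRewardModel.indep_rewards (hX : IsRewardModel P X Pr) (t : ℕ) :
    Indep (rewardsBefore X t) (rewardsAt X t) Pr :=
  indep_iSup_of_disjoint
    (m := fun p : V × Fin K × ℕ => MeasurableSpace.comap (X p.1 p.2.1 p.2.2) inferInstance)
    (S := {p | p.2.2 < t}) (T := {p | p.2.2 = t})
    (fun p => (hX.measurable p.1 p.2.1 p.2.2).comap_le) hX.indep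
    (Set.disjoint_left.2 fun _ h h' => (Nat.ne_of_lt h) h')

/-- Hoeffding's lemma for a single reward. -/
theorem IsRewardModel.lintegral_exp_le_one [IsProbabilityMeasure Pr] (hX : IsRewardModel P X Pr)
    (lam : ℝ) (v : V) (i : Fin K) (t : ℕ) :
    ∫⁻ ω, ENNReal.ofReal (Real.exp (lam * (X v i t ω - armMean P i) - lam ^ 2 / 8)) ∂Pr ≤ 1 := by
  have hmean : Pr[X v i t] = armMean P i := by
    rw [armMean, ← hX.law v i t, integral_map (hX.measurable v i t).aemeasurable (by fun_prop)]
  have hbd : ∀ᵐ ω ∂Pr, X v i t ω ∈ Set.Icc (0 : ℝ) 1 := by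
    have h := hX.bounded i
    rw [← hX.law v i t] at h
    exact ae_of_ae_map (hX.measurable v i t).aemeasurable h
  -- The variance proxy of `[0, 1]` is `(1 / 2) ^ 2`, whence `lam ^ 2 / 8`.
  have hsub := hasSubgaussianMGF_of_mem_Icc (hX.measurable v i t).aemeasurable hbd
  rw [hmean] at hsub
  have hint := hsub.integrable_exp_mul lam
  have hmgf := hsub.mgf_le lam
  simp only [Real.exp_sub _ (lam ^ 2 / 8)]
  rw [← ofReal_integral_eq_lintegral_ofReal (hint.div_const _)
    (Filter.Eventually.of_forall fun ω => by positivity), integral_div]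
  rw [ENNReal.ofReal_le_one, div_le_one (Real.exp_pos _)]
  refine hmgf.trans (Real.exp_le_exp.2 (le_of_eq ?_))
  simp
  ring

variable [Fintype V] {G : SimpleGraph V} {Φ : Policy K G}

/-- The exponential supermartingale of the centred rewards of arm `i` which are collected in the
closed neighbourhood of `v`. -/
theorem IsRewardModel.lintegral_exp_deviation_le_one [IsProbabilityMeasure Pr]
    (hX : IsRewardModel P X Pr) (hΦ : IsUCBNetwork Φ) (lam : ℝ) (v : V) (i : Fin K) (t : ℕ) :
    ∫⁻ ω, ENNReal.ofReal (Real.exp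
      (lam * deviation Φ (fun v i s => X v i s ω) (armMean P i) v i t
        - lam ^ 2 / 8 * pulls Φ (fun v i s => X v i s ω) v i t)) ∂Pr ≤ 1 := by
  classical
  induction t with
  | zero => simp [deviation, pulls]
  | succ t ih =>
  set Z : Ω → ENNReal := fun ω => ENNReal.ofReal (Real.exp
    (lam * deviation Φ (fun v i s => X v i s ω) (armMean P i) v i t
        - lam ^ 2 / 8 * pulls Φ (fun v i s => X v i s ω) v i t)) with hZ
  set W : V → Ω → ENNReal := fun u ω =>
    ENNReal.ofReal (Real.exp (lam * (X u i t ω - armMean P i) - lam ^ 2 / 8)) with hW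
  set D : Ω → Finset V := fun ω =>
    (closedNbhd G v).filter fun u => action Φ (fun v i s => X v i s ω) t u = i with hD
  -- Several neighbours may play `i` in the same round. Splitting by the set `A` of those who do
  -- turns the increment into a product over a fixed set; the event `D ω = A` and `Z` depend on the
  -- past only, the factors `W u` on round `t` only.
  have hstep : ∀ ω, ENNReal.ofReal (Real.exp
      (lam * deviation Φ (fun v i s => X v i s ω) (armMean P i) v i (t + 1)
        - lam ^ 2 / 8 * pulls Φ (fun v i s => X v i s ω) v i (t + 1))) =
      ∑ A ∈ (closedNbhd G v).powerset,
        ((if D ω = A then Z ω else 0) * ∏ u ∈ A, W u ω) := by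
    intro ω
    simp only [ite_mul, zero_mul]
    rw [Finset.sum_ite_eq, if_pos (Finset.mem_powerset.2 (Finset.filter_subset _ _)),
      ← ENNReal.ofReal_prod_of_nonneg (fun _ _ => (Real.exp_pos _).le), ← Real.exp_sum,
      ← ENNReal.ofReal_mul (Real.exp_pos _).le, ← Real.exp_add, deviation_succ, pulls_succ]
    congr 2
    have hsum : ∑ u ∈ D ω, (lam * (X u i t ω - armMean P i) - lam ^ 2 / 8) =
        lam * ∑ u ∈ D ω, (X u i t ω - armMean P i) - (D ω).card * (lam ^ 2 / 8) := by
      rw [Finset.sum_sub_distrib, ← Finset.mul_sum, Finset.sum_const, nsmul_eq_mul]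
    rw [hsum]
    push_cast
    ring
  have hXb : ∀ v i s, s < t → Measurable[rewardsBefore X t] (X v i s) :=
    fun v i s hs => measurable_rewardsBefore hs
  have hZm : Measurable[rewardsBefore X t] Z := by
    refine ENNReal.measurable_ofReal.comp (Real.measurable_exp.comp ?_)
    exact ((hΦ.measurable_deviation hXb _ v i).const_mul _).sub
      ((measurable_from_top.comp (hΦ.measurable_pulls hXb v i)).const_mul _)
  have hDm : ∀ A, MeasurableSet[rewardsBefore X t] {ω | D ω = A} := by
    intro A
    have : {ω | D ω = A} = ⋂ u : V, {ω | u ∈ D ω ↔ u ∈ A} := by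
      ext ω; simp [Finset.ext_iff]
    rw [this]
    refine MeasurableSet.iInter fun u => ?_
    have h1 : MeasurableSet[rewardsBefore X t] {ω | u ∈ D ω} := by
      simp only [hD, Finset.mem_filter]
      exact (MeasurableSet.const _).inter (hΦ.measurableSet_action_eq hXb u i)
    by_cases h : u ∈ A
    · simpa [h] using h1
    · have h2 : {ω | u ∈ D ω ↔ u ∈ A} = {ω | u ∈ D ω}ᶜ := by ext; simp [h]
      exact h2 ▸ h1.compl
  have hWm : ∀ A : Finset V, Measurable[rewardsAt X t] fun ω => ∏ u ∈ A, W u ω := by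
    intro A
    refine Finset.measurable_fun_prod _ fun u _ => ?_
    refine ENNReal.measurable_ofReal.comp (Real.measurable_exp.comp ?_)
    exact (((measurable_rewardsAt u i t).sub_const _).const_mul _).sub_const _
  have hWi : iIndepFun W Pr := by
    have h1 : iIndepFun (fun u : V => X u i t) Pr :=
      hX.indep.precomp (g := fun u : V => (u, i, t)) fun a b h => congrArg Prod.fst h
    exact h1.comp (fun _ y => ENNReal.ofReal (Real.exp (lam * (y - armMean P i) - lam ^ 2 / 8)))
      fun _ => by fun_prop
  have hWp : ∀ A : Finset V, ∫⁻ ω, ∏ u ∈ A, W u ω ∂Pr ≤ 1 := by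
    intro A
    rw [lintegral_prod_eq_prod_lintegral_of_indepFun A W hWi fun u => ?_]
    · exact Finset.prod_le_one' fun u _ => hX.lintegral_exp_le_one lam u i t
    · have := hX.measurable u i t
      fun_prop
  have hZA : ∀ A, Measurable[rewardsBefore X t] fun ω => if D ω = A then Z ω else 0 :=
    fun A => Measurable.ite (hDm A) hZm measurable_const
  simp only [hstep]
  rw [lintegral_finsetSum]
  · calc ∑ A ∈ (closedNbhd G v).powerset,
          ∫⁻ ω, (if D ω = A then Z ω else 0) * ∏ u ∈ A, W u ω ∂Pr
        ≤ ∑ A ∈ (closedNbhd G v).powerset, ∫⁻ ω, (if D ω = A then Z ω else 0) ∂Pr := by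
          refine Finset.sum_le_sum fun A _ => ?_
          rw [lintegral_mul_eq_lintegral_mul_lintegral_of_independent_measurableSpace
            (hX.rewardsBefore_le t) (hX.rewardsAt_le t) (hX.indep_rewards t) (hZA A) (hWm A)]
          exact mul_le_of_le_one_right' (hWp A)
      _ = ∫⁻ ω, Z ω ∂Pr := by
          rw [← lintegral_finsetSum _ fun A _ => (hZA A).mono (hX.rewardsBefore_le t) le_rfl]
          refine lintegral_congr fun ω => ?_
          rw [Finset.sum_ite_eq, if_pos (Finset.mem_powerset.2 (Finset.filter_subset _ _))]
      _ ≤ 1 := ih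
  · exact fun A _ => ((hZA A).mono (hX.rewardsBefore_le t) le_rfl).mul
      ((hWm A).mono (hX.rewardsAt_le t) le_rfl)

end Supermartingale

/-! ### Peeling and numerical estimates -/

section Peeling

/-- A peeling argument: if `exp (lam * Y - lam ^ 2 / 8 * N)` has mean at most one for every `lam`
and the random number `N` varies by a factor of at most `t`, then `Y` exceeds `√(2 ln t N)` with
probability at most `t⁻³`. -/
theorem measure_sqrt_le_le {Ω : Type*} [MeasurableSpace Ω] {Pr : Measure Ω} {Y : Ω → ℝ} {N : Ω → ℕ}
    (hY : Measurable Y) (hN : Measurable N)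
    (hYN : ∀ lam : ℝ,
      ∫⁻ ω, ENNReal.ofReal (Real.exp (lam * Y ω - lam ^ 2 / 8 * N ω)) ∂Pr ≤ 1)
    {q t : ℕ} (hq : 0 < q) (ht : 0 < t) (hqN : ∀ ω, q ≤ N ω) (hNt : ∀ ω, N ω ≤ q * t) :
    Pr {ω | √(2 * Real.log t * N ω) ≤ Y ω} ≤ ENNReal.ofReal ((t : ℝ) ^ 3)⁻¹ := by
  have ht0 : (0 : ℝ) < t := by exact_mod_cast ht
  have hq0 : (0 : ℝ) < q := by exact_mod_cast hq
  have hlog : 0 ≤ Real.log t := Real.log_natCast_nonneg t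
  set k := Nat.log 4 t with hk
  -- On the shell `q * 4 ^ j ≤ N < q * 4 ^ (j + 1)`, put `x = √(N / (q * 4 ^ (j + 1)))`, which lies
  -- in `[1/2, 1]`. The factor `16/3` makes the exponent `(32/3 * x - 64/9 * x ^ 2) * ln t` equal at
  -- both ends, where it is `32/9 * ln t`. By concavity it is at least `7/2 * ln t` throughout.
  set lam : ℕ → ℝ := fun j => 16 / 3 * √(2 * Real.log t / (q * 4 ^ (j + 1))) with hlam
  have hsub : {ω | √(2 * Real.log t * N ω) ≤ Y ω} ⊆ ⋃ j ∈ Finset.range (k + 1),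
      {ω | ENNReal.ofReal (Real.exp (7 / 2 * Real.log t)) ≤
        ENNReal.ofReal (Real.exp (lam j * Y ω - lam j ^ 2 / 8 * N ω))} := by
    intro ω hω
    have hr0 : N ω / q ≠ 0 := (Nat.div_pos (hqN ω) hq).ne'
    set j := Nat.log 4 (N ω / q) with hj
    have h1 : 4 ^ j * q ≤ N ω := (Nat.le_div_iff_mul_le hq).1 (Nat.pow_log_le_self 4 hr0)
    have h2 : N ω < 4 ^ (j + 1) * q :=
      (Nat.div_lt_iff_lt_mul hq).1 (Nat.lt_pow_succ_log_self (by norm_num) _)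
    have hjk : j ≤ k := Nat.log_mono_right (Nat.div_le_of_le_mul (hNt ω))
    refine Set.mem_biUnion (Finset.mem_coe.2 (Finset.mem_range.2 (Nat.lt_succ_of_le hjk))) ?_
    refine ENNReal.ofReal_le_ofReal (Real.exp_le_exp.2 ?_)
    set A : ℝ := q * 4 ^ (j + 1) with hA
    have hA0 : 0 < A := by positivity
    have h1' : (1 / 4 : ℝ) ≤ N ω / A := by
      rw [le_div_iff₀ hA0, hA, pow_succ]
      have : ((4 ^ j * q : ℕ) : ℝ) ≤ N ω := by exact_mod_cast h1
      push_cast at this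
      linarith
    have h2' : N ω / A ≤ 1 := by
      rw [div_le_one hA0, hA]
      have : (N ω : ℝ) ≤ (4 ^ (j + 1) * q : ℕ) := by exact_mod_cast h2.le
      push_cast at this
      linarith
    set x := √(N ω / A) with hx
    have hx1 : 1 / 2 ≤ x := Real.le_sqrt_of_sq_le (by linarith)
    have hx2 : x ≤ 1 := Real.sqrt_le_one.2 h2'
    have hxx : x ^ 2 = N ω / A := Real.sq_sqrt (by positivity)
    have hl2 : lam j ^ 2 / 8 * N ω = 64 / 9 * Real.log t * x ^ 2 := by
      rw [hlam, mul_pow, Real.sq_sqrt (by positivity), hxx]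
      field_simp
      ring
    have hl1 : lam j * √(2 * Real.log t * N ω) = 32 / 3 * Real.log t * x := by
      rw [hlam, mul_assoc, ← Real.sqrt_mul (by positivity),
        show 2 * Real.log t / (q * 4 ^ (j + 1)) * (2 * Real.log t * N ω) =
          (2 * Real.log t) ^ 2 * (N ω / A) by rw [hA]; ring,
        Real.sqrt_mul (by positivity), Real.sqrt_sq (by positivity)]
      ring
    have hlY : lam j * √(2 * Real.log t * N ω) ≤ lam j * Y ω :=
      mul_le_mul_of_nonneg_left hω (by positivity)
    rw [hl2]
    have hquad : 7 / 2 ≤ 32 / 3 * x - 64 / 9 * x ^ 2 := by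
      nlinarith [mul_nonneg (sub_nonneg.2 hx1) (sub_nonneg.2 hx2)]
    nlinarith [mul_le_mul_of_nonneg_left hquad hlog]
  have hmark : ∀ j, Pr {ω | ENNReal.ofReal (Real.exp (7 / 2 * Real.log t)) ≤
      ENNReal.ofReal (Real.exp (lam j * Y ω - lam j ^ 2 / 8 * N ω))} ≤
        ENNReal.ofReal (Real.exp (-(7 / 2 * Real.log t))) := by
    intro j
    have hm : Measurable fun ω =>
        ENNReal.ofReal (Real.exp (lam j * Y ω - lam j ^ 2 / 8 * N ω)) := by
      have : Measurable fun ω => (N ω : ℝ) := measurable_from_top.comp hN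
      fun_prop
    have h := (mul_meas_ge_le_lintegral (μ := Pr) hm
      (ENNReal.ofReal (Real.exp (7 / 2 * Real.log t)))).trans (hYN (lam j))
    rw [Real.exp_neg, ENNReal.ofReal_inv_of_pos (Real.exp_pos _)]
    rw [ENNReal.le_inv_iff_mul_le, mul_comm]
    exact h
  -- Of the exponent `7/2`, the excess `1/2` over `3` pays for the number of shells: `k + 1 ≤ 2 ^ k
  -- ≤ √t`.
  have hcount : ((k + 1 : ℕ) : ℝ) ≤ √t := by
    refine Real.le_sqrt_of_sq_le ?_
    have h1 : k + 1 ≤ 2 ^ k := Nat.lt_two_pow_self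
    have h2 : 4 ^ k ≤ t := Nat.pow_log_le_self 4 ht.ne'
    have h3 : (k + 1) ^ 2 ≤ t := by
      calc (k + 1) ^ 2 ≤ (2 ^ k) ^ 2 := Nat.pow_le_pow_left h1 2
        _ = 4 ^ k := by rw [← pow_mul, mul_comm, pow_mul]; norm_num
        _ ≤ t := h2
    exact_mod_cast h3
  have hexp : Real.exp (-(7 / 2 * Real.log t)) = (√t)⁻¹ * ((t : ℝ) ^ 3)⁻¹ := by
    rw [Real.exp_neg, ← mul_inv, show 7 / 2 * Real.log t = Real.log t / 2 + (3 : ℕ) * Real.log t by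
      push_cast; ring, Real.exp_add, Real.exp_nat_mul, Real.exp_log ht0, Real.exp_half,
      Real.exp_log ht0]
  calc Pr {ω | √(2 * Real.log t * N ω) ≤ Y ω}
      ≤ ∑ j ∈ Finset.range (k + 1), ENNReal.ofReal (Real.exp (-(7 / 2 * Real.log t))) :=
        (measure_mono hsub).trans ((measure_biUnion_finset_le _ _).trans
          (Finset.sum_le_sum fun j _ => hmark j))
    _ = ENNReal.ofReal ((k + 1 : ℕ) * Real.exp (-(7 / 2 * Real.log t))) := by
        rw [Finset.sum_const, Finset.card_range, nsmul_eq_mul,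
          ENNReal.ofReal_mul (Nat.cast_nonneg _), ENNReal.ofReal_natCast]
    _ ≤ ENNReal.ofReal ((t : ℝ) ^ 3)⁻¹ := by
        refine ENNReal.ofReal_le_ofReal ?_
        rw [hexp, ← mul_assoc]
        refine mul_le_of_le_one_left (by positivity) ?_
        rw [← div_eq_mul_inv]
        exact div_le_one_of_le₀ hcount (Real.sqrt_nonneg _)

/-- Telescoping: `t⁻³ ≤ 1 / ((t - 1) t (t + 1))`, which is the difference of consecutive values of
`1 / (2 t (t - 1))`. -/
theorem sum_Ico_inv_cube_le (n : ℕ) : ∑ t ∈ Finset.Ico 2 n, ((t : ℝ) ^ 3)⁻¹ ≤ 1 / 4 := by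
  rcases lt_or_ge n 2 with hn | hn
  · rw [Finset.Ico_eq_empty (by omega)]; norm_num
  suffices h : ∑ t ∈ Finset.Ico 2 n, ((t : ℝ) ^ 3)⁻¹ ≤ 1 / 4 - 1 / (2 * (n * (n - 1))) by
    have h2 : (2 : ℝ) ≤ n := by exact_mod_cast hn
    have : 0 ≤ 1 / (2 * ((n : ℝ) * (n - 1))) :=
      div_nonneg zero_le_one (mul_nonneg zero_le_two (mul_nonneg (by linarith) (by linarith)))
    linarith
  induction n, hn using Nat.le_induction with
  | base => norm_num
  | succ n hn ih =>
    rw [Finset.sum_Ico_succ_top hn]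
    have h2 : (2 : ℝ) ≤ n := by exact_mod_cast hn
    have h1 : (0 : ℝ) < n - 1 := by linarith
    have h3 : ((n : ℝ) ^ 3)⁻¹ ≤
        1 / (2 * ((n : ℝ) * (n - 1))) - 1 / (2 * ((n + 1 : ℝ) * (n + 1 - 1))) := by
      rw [show 1 / (2 * ((n : ℝ) * (n - 1))) - 1 / (2 * ((n + 1 : ℝ) * (n + 1 - 1))) =
        ((n : ℝ) * ((n - 1) * (n + 1)))⁻¹ by
          have : (n : ℝ) + 1 - 1 ≠ 0 := by linarith
          field_simp
          ring]
      refine inv_anti₀ (by positivity) ?_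
      nlinarith
    push_cast
    linarith

/-- By `ln (1/β) ≤ 1/β - 1` the claim becomes algebraic. With `y = 4β - 1` it reads `y * (y - 2) ^ 2
+ 1 ≥ 0`. -/
theorem two_le_addTerm_coeff {β : ℝ} (hβ : β ∈ Set.Ioo (1 / 4 : ℝ) 1) :
    2 ≤ 2 / (4 * β - 1) + 2 / ((4 * β - 1) ^ 2 * Real.log (1 / β)) := by
  obtain ⟨h1, h2⟩ := hβ
  have hβ0 : 0 < β := by linarith
  have hx : 0 < 4 * β - 1 := by linarith
  have hy : 0 < 1 - β := by linarith
  have hlog0 : 0 < Real.log (1 / β) := Real.log_pos ((one_lt_div hβ0).2 h2)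
  have hlog : Real.log (1 / β) ≤ (1 - β) / β := by
    have h := Real.log_le_sub_one_of_pos (one_div_pos.2 hβ0)
    rwa [div_sub_one hβ0.ne'] at h
  have h3 : 2 / ((4 * β - 1) ^ 2 * ((1 - β) / β)) ≤
      2 / ((4 * β - 1) ^ 2 * Real.log (1 / β)) := by gcongr
  refine le_trans ?_ (add_le_add_right h3 _)
  rw [show 2 / (4 * β - 1) + 2 / ((4 * β - 1) ^ 2 * ((1 - β) / β)) =
    2 * ((4 * β - 1) * (1 - β) + β) / ((4 * β - 1) ^ 2 * (1 - β)) by field_simp,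
    le_div_iff₀ (by positivity)]
  nlinarith [mul_nonneg hx.le (sq_nonneg (4 * β - 1 - 2))]

end Peeling

/-! ### Elementary facts on gaps -/

section Gaps

variable {K : ℕ} {P : Fin K → Measure ℝ}

theorem armMean_le_bestMean (i : Fin K) : armMean P i ≤ bestMean P :=
  le_ciSup (Set.finite_range (armMean P)).bddAbove i

theorem gap_nonneg (i : Fin K) : 0 ≤ gap P i := sub_nonneg.2 (armMean_le_bestMean i)

theorem gap_pos_iff {i : Fin K} : 0 < gap P i ↔ armMean P i < bestMean P := sub_pos

theorem exists_armMean_eq_bestMean (hK : 1 ≤ K) : ∃ j, armMean P j = bestMean P :=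
  haveI : Nonempty (Fin K) := ⟨⟨0, hK⟩⟩
  exists_eq_ciSup_of_finite

theorem gap_eq_zero_of_not_lt {i : Fin K} (h : ¬ armMean P i < bestMean P) : gap P i = 0 :=
  le_antisymm (not_lt.1 (gap_pos_iff.not.2 h)) (gap_nonneg i)

end Gaps

/-! ### From plays to expected regret -/

section Regret

variable {V Ω : Type*} [Fintype V] {K : ℕ} {G : SimpleGraph V} {Φ : Policy K G}

/-- The number of pairs of a user and a round in `[K, n)` in which the upper confidence bound of
arm `i` or the one of arm `j` is violated. -/
noncomputable def violations (P : Fin K → Measure ℝ) (Φ : Policy K G) (x : V → Fin K → ℕ → ℝ)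
    (n : ℕ) (i j : Fin K) : ℝ :=
  ∑ v, ∑ t ∈ Finset.Ico K n,
    ((if √(2 * Real.log t * pulls Φ x v i t) ≤ deviation Φ x (armMean P i) v i t then 1 else 0) +
      (if √(2 * Real.log t * pulls Φ x v j t) ≤ -deviation Φ x (armMean P j) v j t then 1 else 0))

theorem networkRegret_eq (P : Fin K → Measure ℝ) (x : V → Fin K → ℕ → ℝ) (n : ℕ) :
    networkRegret P Φ x n = ∑ i, gap P i *
      (∑ v, ((Finset.range n).filter fun t => action Φ x t v = i).card : ℕ) := by
  simp only [networkRegret, Finset.card_filter]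
  push_cast
  simp only [Finset.mul_sum, mul_ite, mul_one, mul_zero]
  conv_rhs => rw [Finset.sum_comm]
  refine Finset.sum_congr rfl fun v _ => ?_
  rw [Finset.sum_comm]
  refine Finset.sum_congr rfl fun t _ => ?_
  rw [Finset.sum_ite_eq, if_pos (Finset.mem_univ _), gap]

/-- A pathwise bound on the number of plays of a suboptimal arm. -/
theorem IsUCBNetwork.sum_card_action_eq_le (hΦ : IsUCBNetwork Φ) {P : Fin K → Measure ℝ}
    {i j : Fin K} (hi : armMean P i < bestMean P) (hj : armMean P j = bestMean P) {C : ℕ}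
    (hC : ∀ I : Finset V, G.IsIndepSet (I : Set V) → I.card ≤ C) (x : V → Fin K → ℕ → ℝ) (n : ℕ) :
    ((∑ v, ((Finset.range n).filter fun t => action Φ x t v = i).card : ℕ) : ℝ) ≤
      C * (8 * Real.log n / gap P i ^ 2 + 1) + Fintype.card V + violations P Φ x n i j := by
  classical
  have hgap : 0 < gap P i := gap_pos_iff.2 hi
  have hlogn : 0 ≤ 8 * Real.log n / gap P i ^ 2 :=
    div_nonneg (mul_nonneg (by norm_num) (Real.log_natCast_nonneg n)) (by positivity)
  -- The `+ 1` makes `l` positive, so that a play with empty past is early; multiplied by the gap,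
  -- it gives the summand `Δ_i` of the main term.
  set l := ⌊8 * Real.log n / gap P i ^ 2⌋₊ + 1 with hl
  have hl1 : 8 * Real.log n / gap P i ^ 2 < l := by
    rw [hl]; push_cast; exact Nat.lt_floor_add_one _
  have hl2 : (l : ℝ) ≤ 8 * Real.log n / gap P i ^ 2 + 1 := by
    rw [hl]; push_cast; linarith [Nat.floor_le hlogn]
  set bad : V → ℕ → Prop := fun v t =>
    √(2 * Real.log t * pulls Φ x v i t) ≤ deviation Φ x (armMean P i) v i t ∨
      √(2 * Real.log t * pulls Φ x v j t) ≤ -deviation Φ x (armMean P j) v j t with hbad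
  set early : V → Finset ℕ := fun v => (Finset.range n).filter fun t =>
    action Φ x t v = i ∧ pulls Φ x v i t < l with hearly
  obtain ⟨I, -, hI, hsum⟩ := exists_isIndepSet_sum_card_early_le (G := G)
    (fun t v => action Φ x t v = i) l n Finset.univ
  have hsum' : ∑ v, (early v).card ≤ C * l + Fintype.card V :=
    hsum.trans (Nat.add_le_add_right (Nat.mul_le_mul_right _ (hC I hI)) _)
  have hsplit : ∀ v, ((Finset.range n).filter fun t => action Φ x t v = i).card ≤
      (early v).card + ((Finset.Ico K n).filter (bad v)).card := by
    intro v
    refine (Finset.card_le_card fun t ht => ?_).trans (Finset.card_union_le _ _)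
    rw [Finset.mem_filter, Finset.mem_range] at ht
    rw [Finset.mem_union]
    rcases lt_or_ge (pulls Φ x v i t) l with h | h
    · exact Or.inl (Finset.mem_filter.2 ⟨Finset.mem_range.2 ht.1, ht.2, h⟩)
    · have hKt : K ≤ t := by
        by_contra! hcon
        rw [hΦ.pulls_eq_zero hcon ht.2] at h
        omega
      refine Or.inr (Finset.mem_filter.2 ⟨Finset.mem_Ico.2 ⟨hKt, ht.1⟩, ?_⟩)
      have ht0 : (0 : ℝ) < t := by exact_mod_cast (Nat.zero_lt_of_lt i.2).trans_le hKt
      have hlt : 8 * Real.log t / gap P i ^ 2 ≤ pulls Φ x v i t := by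
        have h1 : Real.log t ≤ Real.log n := Real.log_le_log ht0 (by exact_mod_cast ht.1.le)
        have h2 : (l : ℝ) ≤ pulls Φ x v i t := by exact_mod_cast h
        have h3 : 8 * Real.log t / gap P i ^ 2 ≤ 8 * Real.log n / gap P i ^ 2 := by gcongr
        linarith
      have h := hΦ.deviation_large hKt (j := j) (c := armMean P j) hgap ht.2 hlt
      rwa [hj, gap, sub_sub_cancel, ← hj] at h
  have hviol : ((∑ v, ((Finset.Ico K n).filter (bad v)).card : ℕ) : ℝ) ≤
      violations P Φ x n i j := by
    simp only [violations, Finset.card_filter]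
    push_cast
    refine Finset.sum_le_sum fun v _ => Finset.sum_le_sum fun t _ => ?_
    simp only [hbad]
    split_ifs <;> first | (exfalso; tauto) | norm_num
  have htot : ∑ v, ((Finset.range n).filter fun t => action Φ x t v = i).card ≤
      C * l + Fintype.card V + ∑ v, ((Finset.Ico K n).filter (bad v)).card := by
    refine (Finset.sum_le_sum fun v _ => hsplit v).trans ?_
    rw [Finset.sum_add_distrib]
    exact Nat.add_le_add_right hsum' _
  have htot' : ((∑ v, ((Finset.range n).filter fun t => action Φ x t v = i).card : ℕ) : ℝ) ≤
      C * l + Fintype.card V + (∑ v, ((Finset.Ico K n).filter (bad v)).card : ℕ) := by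
    exact_mod_cast htot
  have hCl : (C : ℝ) * l ≤ C * (8 * Real.log n / gap P i ^ 2 + 1) := by gcongr
  linarith

variable [MeasurableSpace Ω] {P : Fin K → Measure ℝ} {X : V → Fin K → ℕ → Ω → ℝ}
  {Pr : Measure Ω} [IsProbabilityMeasure Pr]

theorem IsRewardModel.measure_sqrt_le_deviation (hX : IsRewardModel P X Pr) (hΦ : IsUCBNetwork Φ)
    (v : V) (i : Fin K) {t : ℕ} (ht : K ≤ t) :
    Pr.real {ω | √(2 * Real.log t * pulls Φ (fun v i s => X v i s ω) v i t) ≤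
      deviation Φ (fun v i s => X v i s ω) (armMean P i) v i t} ≤ ((t : ℝ) ^ 3)⁻¹ :=
  ENNReal.toReal_le_of_le_ofReal (by positivity) <|
    measure_sqrt_le_le (hΦ.measurable_deviation (fun v i s _ => hX.measurable v i s) _ v i)
      (hΦ.measurable_pulls (fun v i s _ => hX.measurable v i s) v i)
      (fun lam => hX.lintegral_exp_deviation_le_one hΦ lam v i t) card_closedNbhd_pos
      ((Nat.zero_lt_of_lt i.2).trans_le ht) (fun _ => hΦ.le_pulls ht) (fun _ => pulls_le)

theorem IsRewardModel.measure_sqrt_le_neg_deviation (hX : IsRewardModel P X Pr)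
    (hΦ : IsUCBNetwork Φ) (v : V) (i : Fin K) {t : ℕ} (ht : K ≤ t) :
    Pr.real {ω | √(2 * Real.log t * pulls Φ (fun v i s => X v i s ω) v i t) ≤
      -deviation Φ (fun v i s => X v i s ω) (armMean P i) v i t} ≤ ((t : ℝ) ^ 3)⁻¹ :=
  ENNReal.toReal_le_of_le_ofReal (by positivity) <|
    measure_sqrt_le_le (hΦ.measurable_deviation (fun v i s _ => hX.measurable v i s) _ v i).neg
      (hΦ.measurable_pulls (fun v i s _ => hX.measurable v i s) v i)
      (fun lam => by
        simpa using hX.lintegral_exp_deviation_le_one hΦ (-lam) v i t) card_closedNbhd_pos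
      ((Nat.zero_lt_of_lt i.2).trans_le ht) (fun _ => hΦ.le_pulls ht) (fun _ => pulls_le)

theorem integrable_ite_one {p : Ω → Prop} [DecidablePred p] (hp : MeasurableSet {ω | p ω}) :
    Integrable (fun ω => if p ω then (1 : ℝ) else 0) Pr :=
  (integrable_const (1 : ℝ)).indicator hp |>.congr
    (Filter.Eventually.of_forall fun ω => by simp [Set.indicator_apply])

omit [IsProbabilityMeasure Pr] in
theorem integral_ite_one {p : Ω → Prop} [DecidablePred p] (hp : MeasurableSet {ω | p ω}) :
    ∫ ω, (if p ω then (1 : ℝ) else 0) ∂Pr = Pr.real {ω | p ω} := by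
  rw [← integral_indicator_one hp]
  exact integral_congr_ae (Filter.Eventually.of_forall fun ω => by simp [Set.indicator_apply])

/-- The expected number of violated confidence bounds is at most half the number of users. -/
theorem IsRewardModel.integral_violations_le (hX : IsRewardModel P X Pr) (hΦ : IsUCBNetwork Φ)
    (hK : 2 ≤ K) (n : ℕ) (i j : Fin K) :
    Integrable (fun ω => violations P Φ (fun v i s => X v i s ω) n i j) Pr ∧
      ∫ ω, violations P Φ (fun v i s => X v i s ω) n i j ∂Pr ≤ Fintype.card V / 2 := by
  have hXm : ∀ t v i s, s < t → Measurable (X v i s) := fun _ v i s _ => hX.measurable v i s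
  have hsq : ∀ v i (t : ℕ),
      Measurable fun ω => √(2 * Real.log t * pulls Φ (fun v i s => X v i s ω) v i t) :=
    fun v i t => ((measurable_from_top.comp (hΦ.measurable_pulls (hXm t) v i)).const_mul _).sqrt
  have hdev : ∀ v i t,
      Measurable fun ω => deviation Φ (fun v i s => X v i s ω) (armMean P i) v i t :=
    fun v i t => hΦ.measurable_deviation (hXm t) _ v i
  have h1 := fun v t => measurableSet_le (hsq v i t) (hdev v i t)
  have h2 : ∀ v (t : ℕ), MeasurableSet
      {ω | √(2 * Real.log t * pulls Φ (fun v i s => X v i s ω) v j t) ≤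
        -deviation Φ (fun v i s => X v i s ω) (armMean P j) v j t} :=
    fun v t => measurableSet_le (hsq v j t) (hdev v j t).neg
  have hint := fun v t =>
    (integrable_ite_one (Pr := Pr) (h1 v t)).fun_add (integrable_ite_one (h2 v t))
  refine ⟨integrable_finsetSum _ fun v _ => integrable_finsetSum _ fun t _ => hint v t, ?_⟩
  simp only [violations]
  rw [integral_finsetSum _ fun v _ => integrable_finsetSum _ fun t _ => hint v t]
  calc ∑ v, ∫ ω, _ ∂Pr ≤ ∑ _v : V, (1 / 2 : ℝ) := by
        refine Finset.sum_le_sum fun v _ => ?_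
        rw [integral_finsetSum _ fun t _ => hint v t]
        -- Two bounds may fail, each with probability at most `t⁻³`. As `K ≥ 2`, the sum starts at
        -- `t = 2` or later and is at most `2 * (1/4)`.
        calc ∑ t ∈ Finset.Ico K n, ∫ ω, _ ∂Pr ≤ ∑ t ∈ Finset.Ico K n, 2 * ((t : ℝ) ^ 3)⁻¹ := by
              refine Finset.sum_le_sum fun t ht => ?_
              have hKt := (Finset.mem_Ico.1 ht).1
              rw [integral_add (integrable_ite_one (h1 v t)) (integrable_ite_one (h2 v t)),
                integral_ite_one (h1 v t), integral_ite_one (h2 v t)]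
              linarith [hX.measure_sqrt_le_deviation hΦ v i hKt,
                hX.measure_sqrt_le_neg_deviation hΦ v j hKt]
          _ ≤ ∑ t ∈ Finset.Ico 2 n, 2 * ((t : ℝ) ^ 3)⁻¹ :=
              Finset.sum_le_sum_of_subset_of_nonneg (Finset.Ico_subset_Ico_left hK)
                fun _ _ _ => by positivity
          _ ≤ 1 / 2 := by
              rw [← Finset.mul_sum]
              linarith [sum_Ico_inv_cube_le n]
    _ = Fintype.card V / 2 := by
        rw [Finset.sum_const, Finset.card_univ, nsmul_eq_mul]; ring

theorem IsRewardModel.integrable_networkRegret (hX : IsRewardModel P X Pr) (hΦ : IsUCBNetwork Φ)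
    (n : ℕ) : Integrable (fun ω => networkRegret P Φ (fun v i s => X v i s ω) n) Pr := by
  refine integrable_finsetSum _ fun v _ => integrable_finsetSum _ fun t _ => ?_
  have hm : Measurable fun ω =>
      bestMean P - armMean P (action Φ (fun v i s => X v i s ω) t v) :=
    (measurable_from_top (f := fun i => bestMean P - armMean P i)).comp
      (hΦ.measurable_action (fun v i s _ => hX.measurable v i s) v)
  refine Integrable.of_bound hm.aestronglyMeasurable (∑ i, gap P i)
    (Filter.Eventually.of_forall fun ω => ?_)
  change ‖gap P _‖ ≤ _
  rw [Real.norm_of_nonneg (gap_nonneg _)]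
  exact Finset.single_le_sum (f := gap P) (fun i _ => gap_nonneg i) (Finset.mem_univ _)

/-- The regret bound for a network whose independent sets have at most `C` elements. -/
theorem IsRewardModel.integral_networkRegret_le (hX : IsRewardModel P X Pr) (hΦ : IsUCBNetwork Φ)
    (hK : 1 ≤ K) {C : ℕ} (hC : ∀ I : Finset V, G.IsIndepSet (I : Set V) → I.card ≤ C) (n : ℕ)
    {β : ℝ} (hβ : β ∈ Set.Ioo (1 / 4 : ℝ) 1) :
    ∫ ω, networkRegret P Φ (fun v i s => X v i s ω) n ∂Pr ≤
      C * mainTerm P n + addTerm P (Fintype.card V) β := by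
  classical
  obtain ⟨j, hj⟩ := exists_armMean_eq_bestMean (P := P) hK
  set S := Finset.univ.filter fun i => armMean P i < bestMean P with hS
  have hviol : ∀ i ∈ S, Integrable (fun ω => violations P Φ (fun v i s => X v i s ω) n i j) Pr ∧
      ∫ ω, violations P Φ (fun v i s => X v i s ω) n i j ∂Pr ≤ Fintype.card V / 2 := by
    intro i hi
    -- A suboptimal arm differs from the optimal arm `j`, so its existence forces `K ≥ 2`.
    have hij : i ≠ j := by
      rintro rfl
      exact (Finset.mem_filter.1 hi).2.ne hj
    refine hX.integral_violations_le hΦ ?_ n i j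
    have := i.2; have := j.2
    have := Fin.val_ne_of_ne hij
    omega
  set c : Fin K → ℝ := fun i =>
    C * (8 * Real.log n / gap P i ^ 2 + 1) + Fintype.card V with hc
  have hint : ∀ i ∈ S, Integrable (fun ω =>
      gap P i * (c i + violations P Φ (fun v i s => X v i s ω) n i j)) Pr :=
    fun i hi => ((integrable_const _).add (hviol i hi).1).const_mul _
  have hpath : ∀ ω, networkRegret P Φ (fun v i s => X v i s ω) n ≤
      ∑ i ∈ S, gap P i * (c i + violations P Φ (fun v i s => X v i s ω) n i j) := by
    intro ω
    rw [networkRegret_eq, ← Finset.sum_subset (Finset.subset_univ S)]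
    · exact Finset.sum_le_sum fun i hi => mul_le_mul_of_nonneg_left
        (hΦ.sum_card_action_eq_le (Finset.mem_filter.1 hi).2 hj hC _ n) (gap_nonneg i)
    · intro i _ hi
      rw [gap_eq_zero_of_not_lt fun h => hi (Finset.mem_filter.2 ⟨Finset.mem_univ _, h⟩), zero_mul]
  have hgaps : ∑ i ∈ S, gap P i ≤ ∑ i, gap P i :=
    Finset.sum_le_sum_of_subset_of_nonneg (Finset.subset_univ S) fun i _ _ => gap_nonneg i
  have hgaps0 : 0 ≤ ∑ i, gap P i := Finset.sum_nonneg fun i _ => gap_nonneg i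
  calc ∫ ω, networkRegret P Φ (fun v i s => X v i s ω) n ∂Pr
      ≤ ∫ ω, ∑ i ∈ S, gap P i * (c i + violations P Φ (fun v i s => X v i s ω) n i j) ∂Pr :=
        integral_mono (hX.integrable_networkRegret hΦ n) (integrable_finsetSum _ hint) hpath
    _ ≤ ∑ i ∈ S, gap P i * (c i + Fintype.card V / 2) := by
        rw [integral_finsetSum _ hint]
        refine Finset.sum_le_sum fun i hi => ?_
        rw [integral_const_mul, integral_add (integrable_const _) (hviol i hi).1, integral_const,
          probReal_univ, one_smul]
        exact mul_le_mul_of_nonneg_left (by linarith [(hviol i hi).2]) (gap_nonneg i)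
    -- The `3/2` is one early play per user from the combinatorial bound plus `1/2` for the
    -- violations.
    _ = C * mainTerm P n + Fintype.card V * (3 / 2 * ∑ i ∈ S, gap P i) := by
        rw [mainTerm, Finset.mul_sum, Finset.mul_sum, Finset.mul_sum, ← hS,
          ← Finset.sum_add_distrib]
        refine Finset.sum_congr rfl fun i hi => ?_
        have : gap P i ≠ 0 := (gap_pos_iff.2 (Finset.mem_filter.1 hi).2).ne'
        rw [hc]
        field_simp
        ring
    _ ≤ C * mainTerm P n + addTerm P (Fintype.card V) β := by
        rw [addTerm, mul_assoc]
        refine add_le_add_right (mul_le_mul_of_nonneg_left ?_ (Nat.cast_nonneg _)) _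
        nlinarith [mul_le_mul_of_nonneg_right (two_le_addTerm_coeff hβ) hgaps0]

end Regret

end NetworkBandit

theorem mainTheorem8 {V Ω : Type*} [Fintype V] [MeasurableSpace Ω]
    (Pr : Measure Ω) [IsProbabilityMeasure Pr]
    (G : SimpleGraph V) (m : ℕ) (hm : Fintype.card V = m) (K : ℕ) (hK : 1 ≤ K)
    (P : Fin K → Measure ℝ) [∀ i, IsProbabilityMeasure (P i)]
    (X : V → Fin K → ℕ → Ω → ℝ) (hX : IsRewardModel P X Pr)
    (Φ : Policy K G) (hΦ : IsUCBNetwork Φ)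
    (n : ℕ) (hn : 1 ≤ n) (β : ℝ) (hβ : β ∈ Set.Ioo (1 / 4 : ℝ) 1)
    (R : Ω → ℝ) (hR : ∀ ω, R ω = networkRegret P Φ (fun v i t => X v i t ω) n) :
    Integrable R Pr ∧
    -- fully connected network
    (G = ⊤ → ∫ ω, R ω ∂Pr ≤ mainTerm P n + addTerm P m β) ∧
    -- circular network
    (2 ≤ m → Nonempty (G ≃g SimpleGraph.cycleGraph m) →
      ∫ ω, R ω ∂Pr ≤ ((m / 2 : ℕ) : ℝ) * mainTerm P n + addTerm P m β) ∧
    -- star network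
    (2 ≤ m → (∃ c : V, G = SimpleGraph.starGraph c) →
      ∫ ω, R ω ∂Pr ≤ ((m : ℝ) - 1) * mainTerm P n + addTerm P m β) ∧
    -- fully disconnected network
    (G = ⊥ → ∫ ω, R ω ∂Pr ≤ (m : ℝ) * mainTerm P n + addTerm P m β) := by

  obtain rfl : R = fun ω => networkRegret P Φ (fun v i t => X v i t ω) n := funext hR
  subst hm
  have key : ∀ C : ℕ, (∀ I : Finset V, G.IsIndepSet (I : Set V) → I.card ≤ C) →
      ∫ ω, networkRegret P Φ (fun v i t => X v i t ω) n ∂Pr ≤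
        C * mainTerm P n + addTerm P (Fintype.card V) β :=
    fun C hC => hX.integral_networkRegret_le hΦ hK hC n hβ
  refine ⟨hX.integrable_networkRegret hΦ n, ?_, ?_, ?_, ?_⟩
  · rintro rfl
    simpa using key 1 fun I hI => isIndepSet_top_card_le hI
  · rintro hm ⟨e⟩
    exact key _ fun I hI => isIndepSet_cycleGraph_card_le hm e hI
  · rintro hm ⟨c, rfl⟩
    have h := key (Fintype.card V - 1) fun I hI =>
      Nat.le_sub_one_of_lt (isIndepSet_starGraph_card_lt hm hI)
    rwa [Nat.cast_sub (by omega), Nat.cast_one] at h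
  · rintro -
    exact key _ fun I _ => Finset.card_le_univ I
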